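/- A tiling of the unit square $[0,1]^2$ with $n$ tiles is a family of $n$ closed squares (the tiles), each of positive side length, whose union is $[0,1]^2$ and whose interiors are pairwise disjoint. For such a tiling $T$ with tiles of side lengths $s_1,\dots,s_n$ let $\sigma(T)=s_1+\cdots+s_n$, and let $f_m(n)=\min_T\sigma(T)$, where $T$ runs over all tilings of the unit square with $n$ tiles. **Theorem.** For every integer $k\ge 2$ the minima $f_m(2k)$ and $f_m(2k+3)$ exist, and $$f_m(2k)=3-\frac2k,\qquad f_m(2k+3)=3-\frac1k .$$ The value $f_m(2k)$ is attained by a tiling with one tile of side $\frac{k-1}{k}$ and $2k-1$ tiles of side $\frac1k$. The value $f_m(2k+3)$ is attained by a tiling with one tile of side $\frac{k-1}{k}$, $2k-2$ tiles of side $\frac1k$ and four tiles of side $\frac1{2k}$. In particular, $f_m(7)=\frac52$. -/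

import Mathlib

open Set

/-- A (nondegenerate, closed, possibly rotated) square in the plane, given by one of its corners,
the unit vector along one of its sides leaving that corner (the adjacent side is obtained by a
counterclockwise quarter turn), and its positive side length. -/
structure PlaneSquare where
  corner : ℝ × ℝ
  dir : ℝ × ℝ
  side : ℝ
  dir_unit : dir.1 ^ 2 + dir.2 ^ 2 = 1
  side_pos : 0 < side

/-- The set of points of a square, boundary included. -/
def PlaneSquare.carrier (Q : PlaneSquare) : Set (ℝ × ℝ) :=
  {p | ∃ u ∈ Icc (0 : ℝ) Q.side, ∃ v ∈ Icc (0 : ℝ) Q.side,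
    p = (Q.corner.1 + u * Q.dir.1 - v * Q.dir.2, Q.corner.2 + u * Q.dir.2 + v * Q.dir.1)}

/-- The unit square with corners `(0,0)`, `(0,1)`, `(1,0)`, `(1,1)`. -/
def unitSquareRegion : Set (ℝ × ℝ) := Icc (0 : ℝ) 1 ×ˢ Icc (0 : ℝ) 1

/-- The `n` squares `T i` (the tiles) fill the unit square exactly, and have pairwise disjoint
interiors. -/
def IsSquareTiling {n : ℕ} (T : Fin n → PlaneSquare) : Prop :=
  (⋃ i, (T i).carrier) = unitSquareRegion ∧
    ∀ i j, i ≠ j → Disjoint (interior (T i).carrier) (interior (T j).carrier)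

/-- The total length `σ(T)`: the sum of the side lengths of the tiles. -/
noncomputable def totalLength {n : ℕ} (T : Fin n → PlaneSquare) : ℝ := ∑ i, (T i).side

/-- The multiset of side lengths of the tiles. -/
noncomputable def sideLengths {n : ℕ} (T : Fin n → PlaneSquare) : Multiset ℝ :=
  Finset.univ.val.map fun i => (T i).side

/-- The total lengths of all tilings of the unit square with `n` tiles. -/
def tilingLengths (n : ℕ) : Set ℝ :=
  {L | ∃ T : Fin n → PlaneSquare, IsSquareTiling T ∧ totalLength T = L}

/-- `f_m(n)`: the infimum of the total lengths of all tilings of the unit square with `n` tiles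
(that it is a minimum is expressed by `IsLeast (tilingLengths n) (minTilingLength n)`). -/
noncomputable def minTilingLength (n : ℕ) : ℝ := sInf (tilingLengths n)

/-! No tile of a tiling of the unit square is tilted (`dir_snd_eq_zero`), so a tiling is a packing
of axis-parallel squares of full area. For the lower bounds, consider a packing of a square of side
`L` with total length below `3L`; otherwise there is nothing to prove.

The number of tiles met by a horizontal line, integrated over its height, is the total length. So
some generic horizontal line meets at most two tiles, hence exactly two, and their sides add up to
`L`. The same holds for some vertical line. The tile `z` through the crossing point belongs to both
pairs; up to symmetry it sits in the lower left corner, with a tile `q` to its right and a tile `p`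
above it, both of side `L - s z` (`exists_corner`). Thus `z` is bordered by an L-shape whose width
is the side of `q` and of `p`.

Delete `q` and `p`, close the gaps and shrink `z` by that width. This leaves a packing of a square
of side `s z` (`reduce`), and three times the side minus the total length is unchanged. Iteration
ends with a single tile of side `u`, so the total length was `3L - 2u`. Undoing the steps shows that
all sides, and `L = m u`, are integer multiples of `u` (`structure_of_lt`).

A step removes two tiles, or three if `z` vanishes, which happens exactly when `L` is halved.
Counting gives `n ≤ 2m` for `n > 1` tiles, and `n ≤ m + 3` for odd `n`. With `L = 1` these bound `u
= 1/m` from above, hence the total length from below. Equality comes from one big square with a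
border of small ones, whose corner tile is cut into four in the odd case (`exists_bordered_tiling`).
-/

/-- The axis-parallel squares with lower left corners `(x i, y i)` and sides `s i`, `i ∈ S`, lie in
`[0, L]²`, do not overlap, and have total area `L²`. -/
structure FullPacking {ι : Type*} (S : Finset ι) (x y s : ι → ℝ) (L : ℝ) : Prop where
  pos : ∀ i ∈ S, 0 < s i
  x_nonneg : ∀ i ∈ S, 0 ≤ x i
  x_le : ∀ i ∈ S, x i + s i ≤ L
  y_nonneg : ∀ i ∈ S, 0 ≤ y i
  y_le : ∀ i ∈ S, y i + s i ≤ L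
  sep : ∀ i ∈ S, ∀ j ∈ S, i ≠ j →
    x i + s i ≤ x j ∨ x j + s j ≤ x i ∨ y i + s i ≤ y j ∨ y j + s j ≤ y i
  area : ∑ i ∈ S, s i ^ 2 = L ^ 2

/-! ### Packings of full area: coverage, sparse lines and the corner configuration. -/

namespace FullPacking

variable {ι : Type*} {S : Finset ι} {x y s : ι → ℝ} {L : ℝ}

theorem transpose (P : FullPacking S x y s L) : FullPacking S y x s L where
  pos := P.pos
  x_nonneg := P.y_nonneg
  x_le := P.y_le
  y_nonneg := P.x_nonneg
  y_le := P.x_le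
  sep i hi j hj hij := by have := P.sep i hi j hj hij; tauto
  area := P.area

theorem reflect (P : FullPacking S x y s L) :
    FullPacking S (fun i => L - x i - s i) y s L where
  pos := P.pos
  x_nonneg i hi := by linarith [P.x_le i hi]
  x_le i hi := by linarith [P.x_nonneg i hi]
  y_nonneg := P.y_nonneg
  y_le := P.y_le
  sep i hi j hj hij := by
    rcases P.sep i hi j hj hij with h | h | h | h
    · exact Or.inr (Or.inl (by linarith))
    · exact Or.inl (by linarith)
    · exact Or.inr (Or.inr (Or.inl h))
    · exact Or.inr (Or.inr (Or.inr h))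
  area := P.area

open MeasureTheory in
theorem volume_openBox (a b t : ℝ) (ht : 0 ≤ t) :
    volume (Ioo a (a + t) ×ˢ Ioo b (b + t)) = ENNReal.ofReal (t ^ 2) := by
  rw [Measure.volume_eq_prod, Measure.prod_prod, Real.volume_Ioo, Real.volume_Ioo,
    ← ENNReal.ofReal_mul (by linarith)]
  congr 1; ring

open MeasureTheory in
theorem volume_closedBox (a b t : ℝ) (ht : 0 ≤ t) :
    volume (Icc a (a + t) ×ˢ Icc b (b + t)) = ENNReal.ofReal (t ^ 2) := by
  rw [Measure.volume_eq_prod, Measure.prod_prod, Real.volume_Icc, Real.volume_Icc,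
    ← ENNReal.ofReal_mul (by linarith)]
  congr 1; ring

theorem disjoint_openBox (P : FullPacking S x y s L) {i j : ι} (hi : i ∈ S) (hj : j ∈ S)
    (hij : i ≠ j) : Disjoint (Ioo (x i) (x i + s i) ×ˢ Ioo (y i) (y i + s i))
      (Ioo (x j) (x j + s j) ×ˢ Ioo (y j) (y j + s j)) := by
  rw [Set.disjoint_left]
  rintro ⟨a, b⟩ ⟨⟨h1, h2⟩, h3, h4⟩ ⟨⟨h5, h6⟩, h7, h8⟩
  simp only at *
  rcases P.sep i hi j hj hij with h | h | h | h <;> linarith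

-- An uncovered point has a neighbourhood free of tiles. The point may lie on the boundary of the
-- big square, but it is in the closure of the open square, so the neighbourhood meets that in
-- positive area. The tiles, being disjoint of total area `L²`, leave no such room.
open MeasureTheory in
theorem cover (P : FullPacking S x y s L) (hL : 0 < L) {X Y : ℝ} (hX : X ∈ Icc 0 L)
    (hY : Y ∈ Icc 0 L) :
    ∃ i ∈ S, X ∈ Icc (x i) (x i + s i) ∧ Y ∈ Icc (y i) (y i + s i) := by
  by_contra! hne
  set F : Set (ℝ × ℝ) := ⋃ i ∈ S, Icc (x i) (x i + s i) ×ˢ Icc (y i) (y i + s i) with hF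
  have hFc : IsClosed F :=
    S.finite_toSet.isClosed_biUnion fun i _ => isClosed_Icc.prod isClosed_Icc
  set O : Set (ℝ × ℝ) := Ioo 0 L ×ˢ Ioo 0 L with hO
  have hmem : (X, Y) ∈ Fᶜ := by
    simp only [hF, mem_compl_iff, mem_iUnion, not_exists]
    intro i hi h
    exact hne i hi h.1 h.2
  have hcl : (X, Y) ∈ closure O := by
    rw [hO, closure_prod_eq, closure_Ioo hL.ne]
    exact ⟨hX, hY⟩
  have hOo : IsOpen O := isOpen_Ioo.prod isOpen_Ioo
  have hU : 0 < volume (Fᶜ ∩ O) := by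
    exact (hFc.isOpen_compl.inter hOo).measure_pos volume
      (mem_closure_iff.1 hcl _ hFc.isOpen_compl hmem)
  set G : Set (ℝ × ℝ) := ⋃ i ∈ S, Ioo (x i) (x i + s i) ×ˢ Ioo (y i) (y i + s i) with hG
  have hGv : volume G = ENNReal.ofReal (L ^ 2) := by
    rw [hG, measure_biUnion_finset]
    · rw [← P.area, ENNReal.ofReal_sum_of_nonneg fun i _ => sq_nonneg _]
      exact Finset.sum_congr rfl fun i hi => volume_openBox _ _ _ (P.pos i hi).le
    · intro i hi j hj hij
      exact P.disjoint_openBox hi hj hij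
    · intro i _
      exact (measurableSet_Ioo.prod measurableSet_Ioo)
  have hOv : volume O = ENNReal.ofReal (L ^ 2) := by
    simpa using volume_openBox 0 0 L hL.le
  have hGF : G ⊆ F := iUnion₂_mono fun i _ => prod_mono Ioo_subset_Icc_self Ioo_subset_Icc_self
  have hGO : G ⊆ O := iUnion₂_subset fun i hi => prod_mono
    (Ioo_subset_Ioo (P.x_nonneg i hi) (P.x_le i hi)) (Ioo_subset_Ioo (P.y_nonneg i hi) (P.y_le i hi))
  have hle : volume G + volume (Fᶜ ∩ O) ≤ volume O := by
    rw [← measure_union]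
    · exact measure_mono (union_subset hGO inter_subset_right)
    · exact Set.disjoint_left.2 fun p hp hp' => hp'.1 (hGF hp)
    · exact (hFc.isOpen_compl.inter hOo).measurableSet
  rw [hGv, hOv] at hle
  have := ENNReal.add_lt_add_left (a := ENNReal.ofReal (L ^ 2)) ENNReal.ofReal_ne_top hU
  rw [add_zero] at this
  exact absurd hle (not_le.2 this)

open MeasureTheory in
/-- If the total length is less than `3L`, some generic horizontal line meets at most two tiles. -/
theorem exists_level (P : FullPacking S x y s L) (h : ∑ i ∈ S, s i < 3 * L) :
    ∃ Y ∈ Ioo 0 L, (∀ i ∈ S, Y ≠ y i ∧ Y ≠ y i + s i) ∧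
      (S.filter fun i => y i < Y ∧ Y < y i + s i).card ≤ 2 := by
  by_contra! hne
  set N : Set ℝ := ↑(S.image y ∪ S.image fun i => y i + s i) with hN
  have hN0 : volume N = 0 := (Finset.finite_toSet _).measure_zero _
  -- The right-hand integrand counts the tiles whose open vertical range contains `Y`. It is at
  -- least 3 off the null set `N` of edge heights, while its integral is the total length.
  have h1 : ∫⁻ _ in Ioo 0 L, (3 : ENNReal) ≤
      ∫⁻ Y, ∑ i ∈ S, (Ioo (y i) (y i + s i)).indicator 1 Y := by
    rw [← lintegral_indicator measurableSet_Ioo]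
    apply lintegral_mono_ae
    filter_upwards [measure_eq_zero_iff_ae_notMem.1 hN0] with Y hY
    by_cases hYL : Y ∈ Ioo 0 L
    · have hgen : ∀ i ∈ S, Y ≠ y i ∧ Y ≠ y i + s i := by
        intro i hi
        constructor
        · rintro rfl
          exact hY (by simp only [hN, Finset.coe_union, Finset.coe_image]; exact Or.inl ⟨i, hi, rfl⟩)
        · rintro rfl
          exact hY (by simp only [hN, Finset.coe_union, Finset.coe_image]; exact Or.inr ⟨i, hi, rfl⟩)
      have h3 := hne Y hYL hgen
      have : ∑ i ∈ S, (Ioo (y i) (y i + s i)).indicator (1 : ℝ → ENNReal) Y =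
          ((S.filter fun i => y i < Y ∧ Y < y i + s i).card : ENNReal) := by
        rw [Finset.card_filter]
        push_cast
        refine Finset.sum_congr rfl fun i _ => ?_
        simp [indicator_apply]
      rw [this, indicator_of_mem hYL]
      exact_mod_cast h3
    · rw [indicator_of_notMem hYL]; exact zero_le
  rw [lintegral_finsetSum _ fun i _ => measurable_one.indicator measurableSet_Ioo] at h1
  simp only [setLIntegral_const, Real.volume_Ioo, sub_zero] at h1
  have h2 : ∑ i ∈ S, ∫⁻ Y, (Ioo (y i) (y i + s i)).indicator (1 : ℝ → ENNReal) Y =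
      ENNReal.ofReal (∑ i ∈ S, s i) := by
    rw [ENNReal.ofReal_sum_of_nonneg fun i hi => (P.pos i hi).le]
    refine Finset.sum_congr rfl fun i _ => ?_
    rw [lintegral_indicator_one measurableSet_Ioo, Real.volume_Ioo]
    congr 1; ring
  rw [h2, show (3 : ENNReal) = ENNReal.ofReal 3 by norm_num, ← ENNReal.ofReal_mul (by norm_num),
    ENNReal.ofReal_le_ofReal_iff (Finset.sum_nonneg fun i hi => (P.pos i hi).le)] at h1
  linarith

theorem side_lt (P : FullPacking S x y s L) (hS : 1 < S.card) {i : ι} (hi : i ∈ S) : s i < L := by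
  obtain ⟨j, hj, hji⟩ := Finset.exists_mem_ne hS i
  have h0 := P.pos j hj
  have := P.x_nonneg i hi; have := P.x_le i hi; have := P.y_nonneg i hi; have := P.y_le i hi
  have := P.x_nonneg j hj; have := P.x_le j hj; have := P.y_nonneg j hj; have := P.y_le j hj
  rcases P.sep j hj i hi hji with h | h | h | h <;> linarith

/-- If the total length is less than `3L`, some horizontal line meets exactly two tiles. -/
theorem exists_row (P : FullPacking S x y s L) (hL : 0 < L) (h : ∑ i ∈ S, s i < 3 * L)
    (hS : 1 < S.card) :
    ∃ Y ∈ Ioo 0 L, ∃ i ∈ S, ∃ j ∈ S, i ≠ j ∧ x i = 0 ∧ x j = s i ∧ s i + s j = L ∧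
      (y i < Y ∧ Y < y i + s i) ∧ (y j < Y ∧ Y < y j + s j) ∧
      ∀ l ∈ S, Y ∈ Icc (y l) (y l + s l) → l = i ∨ l = j := by
  classical
  obtain ⟨Y, hY, hgen, hcard⟩ := P.exists_level h
  have hopen : ∀ l ∈ S, Y ∈ Icc (y l) (y l + s l) →
      l ∈ S.filter fun i => y i < Y ∧ Y < y i + s i := by
    intro l hl hl'
    exact Finset.mem_filter.2
      ⟨hl, lt_of_le_of_ne hl'.1 (hgen l hl).1.symm, lt_of_le_of_ne hl'.2 (hgen l hl).2⟩
  have hY' : Y ∈ Icc 0 L := ⟨hY.1.le, hY.2.le⟩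
  obtain ⟨i, hi, hi0, hiY⟩ := P.cover hL (left_mem_Icc.2 hL.le) hY'
  obtain ⟨j, hj, hjL, hjY⟩ := P.cover hL (right_mem_Icc.2 hL.le) hY'
  have hxi : x i = 0 := le_antisymm hi0.1 (P.x_nonneg i hi)
  have hxj : x j + s j = L := le_antisymm (P.x_le j hj) hjL.2
  have hij : i ≠ j := by
    rintro rfl
    linarith [P.side_lt hS hi]
  have hi' := hopen i hi hiY
  have hj' := hopen j hj hjY
  have hall : ∀ l ∈ S, Y ∈ Icc (y l) (y l + s l) → l = i ∨ l = j := by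
    intro l hl hlY
    by_contra! hne
    have : ({l, i, j} : Finset ι) ⊆ S.filter fun i => y i < Y ∧ Y < y i + s i := by
      intro k hk
      simp only [Finset.mem_insert, Finset.mem_singleton] at hk
      rcases hk with rfl | rfl | rfl
      exacts [hopen _ hl hlY, hi', hj']
    have := Finset.card_le_card this
    rw [Finset.card_eq_three.2 ⟨l, i, j, hne.1, hne.2, hij, rfl⟩] at this
    omega
  have hi2 := (Finset.mem_filter.1 hi').2
  have hj2 := (Finset.mem_filter.1 hj').2
  -- Both tiles contain the level `Y` in their open vertical ranges, so they cannot be separated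
  -- vertically.
  have hle : x i + s i ≤ x j := by
    have := P.pos i hi; have := P.pos j hj
    rcases P.sep i hi j hj hij with h | h | h | h <;> linarith
  have hxj' : x j = s i := by
    by_contra hne
    have hlt : x i + s i < x j := lt_of_le_of_ne hle (by rw [hxi, zero_add]; exact Ne.symm hne)
    have := P.pos i hi; have := P.pos j hj
    obtain ⟨l, hl, hlX, hlY⟩ := P.cover hL (X := (x i + s i + x j) / 2)
      ⟨by linarith, by linarith⟩ hY'
    rcases hall l hl hlY with rfl | rfl
    · linarith [hlX.2]
    · linarith [hlX.1]
  exact ⟨Y, hY, i, hi, j, hj, hij, hxi, hxj', by linarith, hi2, hj2, hall⟩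

/-- If the total length is less than `3L`, then after reflections the lower left tile `z`, the tile
`q` and the tile `p` are as in a tiling by one big square bordered by an L-shape. -/
theorem exists_corner (P : FullPacking S x y s L) (hL : 0 < L) (h : ∑ i ∈ S, s i < 3 * L)
    (hS : 1 < S.card) :
    ∃ x' y' : ι → ℝ, FullPacking S x' y' s L ∧ ∃ z ∈ S, ∃ q ∈ S, ∃ p ∈ S, z ≠ q ∧ z ≠ p ∧
      x' z = 0 ∧ y' z = 0 ∧ x' q = s z ∧ y' q < s z ∧ y' p = s z ∧ x' p < s z ∧
      s z + s q = L ∧ s z + s p = L := by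
  obtain ⟨Y, hY, i, hi, j, hj, hij, hxi, hxj, hsij, hiY, hjY, hall⟩ := P.exists_row hL h hS
  obtain ⟨X, hX, k, hk, l, hl, hkl, hyk, hyl, hskl, hkX, hlX, hall'⟩ :=
    P.transpose.exists_row hL h hS
  obtain ⟨z, hz, hzX, hzY⟩ := P.cover hL (X := X) (Y := Y) ⟨hX.1.le, hX.2.le⟩ ⟨hY.1.le, hY.2.le⟩
  -- The crossing tile `z` is the left or right member of the row and the lower or upper member of
  -- the column; reflections bring it to the lower left.
  rcases hall z hz hzY with rfl | rfl <;> rcases hall' z hz hzX with rfl | rfl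
  · exact ⟨x, y, P, z, hz, j, hj, l, hl, hij, hkl, hxi, hyk, hxj, by linarith, hyl, by linarith,
      hsij, hskl⟩
  · refine ⟨x, _, P.transpose.reflect.transpose, z, hz, j, hj, k, hk, hij, hkl.symm, hxi, ?_, hxj,
      ?_, ?_, ?_, hsij, ?_⟩ <;> linarith
  · refine ⟨_, y, P.reflect, z, hz, i, hi, l, hl, hij.symm, hkl, ?_, hyk, ?_, ?_, hyl, ?_, ?_, hskl⟩
      <;> linarith
  · refine ⟨_, _, P.reflect.transpose.reflect.transpose, z, hz, i, hi, k, hk, hij.symm, hkl.symm,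
      ?_, ?_, ?_, ?_, ?_, ?_, ?_, ?_⟩ <;> linarith

end FullPacking

/-! ### The reduction step, the induction and the lower bounds. -/

namespace FullPacking

variable {ι : Type*} {S : Finset ι} {x y s : ι → ℝ} {L : ℝ}

theorem sum_erase_three [DecidableEq ι] {z q p : ι} (hz : z ∈ S) (hq : q ∈ S) (hp : p ∈ S)
    (hzq : z ≠ q) (hzp : z ≠ p) (hqp : q ≠ p) (f : ι → ℝ) :
    ∑ i ∈ S, f i = f z + f q + f p + ∑ i ∈ ((S.erase q).erase p).erase z, f i := by
  rw [← Finset.add_sum_erase S f hq,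
    ← Finset.add_sum_erase (S.erase q) f (Finset.mem_erase.2 ⟨hqp.symm, hp⟩),
    ← Finset.add_sum_erase ((S.erase q).erase p) f
      (Finset.mem_erase.2 ⟨hzp, Finset.mem_erase.2 ⟨hzq, hz⟩⟩)]
  ring

set_option maxHeartbeats 800000 in
/-- Removing the tiles `q` and `p` and shrinking the corner tile `z`, where `p` lies over `z`. -/
theorem reduce_of_le [DecidableEq ι] (P : FullPacking S x y s L) {z q p : ι} (hz : z ∈ S)
    (hq : q ∈ S) (hp : p ∈ S) (hzq : z ≠ q) (hzp : z ≠ p)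
    (hxz : x z = 0) (hyz : y z = 0) (hxq : x q = s z) (hyq : y q < s z) (hyp : y p = s z)
    (hxp : x p < s z) (hsq : s z + s q = L) (hsp : s z + s p = L) (hle : x p + s p ≤ s z)
    {S' : Finset ι} (hS' : ∀ i, i ∈ S' ↔ i ∈ S ∧ i ≠ q ∧ i ≠ p ∧ (i = z → 2 * s z ≠ L)) :
    ∃ x' y', FullPacking S' x' y' (Function.update s z (2 * s z - L)) (s z) := by
  have hqp : q ≠ p := by rintro rfl; linarith
  have hxp0 := P.x_nonneg p hp
  have hyq0 := P.y_nonneg q hq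
  have hyqL := P.y_le q hq
  have hL2 : L ≤ 2 * s z := by linarith
  have hrow : ∀ i ∈ S, i ≠ z → s z ≤ x i ∨ s z ≤ y i := by
    intro i hi hiz
    have := P.pos i hi; have := P.x_nonneg i hi; have := P.y_nonneg i hi
    rcases P.sep i hi z hz hiz with h | h | h | h
    · linarith
    · left; linarith
    · linarith
    · right; linarith
  have hcol : ∀ i ∈ S, i ≠ q → x i + s i ≤ s z ∨ y i + s i ≤ y q ∨ y q + s q ≤ y i := by
    intro i hi hiq
    have := P.pos i hi; have := P.x_le i hi
    rcases P.sep i hi q hq hiq with h | h | h | h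
    · left; linarith
    · linarith
    · exact Or.inr (Or.inl h)
    · exact Or.inr (Or.inr h)
  have htop : ∀ i ∈ S, i ≠ p → y i + s i ≤ s z ∨ x i + s i ≤ x p ∨ x p + s p ≤ x i := by
    intro i hi hip
    have := P.pos i hi; have := P.y_le i hi
    rcases P.sep i hi p hp hip with h | h | h | h
    · exact Or.inr (Or.inl h)
    · exact Or.inr (Or.inr h)
    · left; linarith
    · linarith
  -- Tiles left of `p` keep their abscissa and all others slide left by `s p`; tiles of the right
  -- strip below `q` keep their ordinate and all others slide down by `s q`. The shrunken `z` stays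
  -- at the origin.
  obtain ⟨x', hx'⟩ : ∃ x' : ι → ℝ, x' = fun i =>
    if i = z then 0 else if x i < x p then x i else x i - s p := ⟨_, rfl⟩
  obtain ⟨y', hy'⟩ : ∃ y' : ι → ℝ, y' = fun i =>
    if i = z then 0 else if y i < y q then y i else y i - s q := ⟨_, rfl⟩
  have hxz' : x' z = 0 := by simp [hx']
  have hyz' : y' z = 0 := by simp [hy']
  have hX : ∀ i ∈ S, i ≠ z → i ≠ q → i ≠ p →
      (x i + s i ≤ x p ∧ s z ≤ y i ∧ x' i = x i) ∨
      (x p + s p ≤ x i ∧ x' i = x i - s p) := by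
    intro i hi hiz hiq hip
    have := P.pos i hi
    simp only [hx', if_neg hiz]
    split_ifs with hlt
    · left
      rcases hrow i hi hiz with h | h
      · linarith
      · rcases htop i hi hip with h' | h' | h'
        · linarith
        · exact ⟨h', h, rfl⟩
        · linarith [P.pos p hp]
    · right
      refine ⟨?_, rfl⟩
      rcases hrow i hi hiz with h | h
      · linarith
      · rcases htop i hi hip with h' | h' | h' <;> linarith
  have hY : ∀ i ∈ S, i ≠ z → i ≠ q → i ≠ p →
      (y i + s i ≤ y q ∧ s z ≤ x i ∧ y' i = y i) ∨
      (y q ≤ y i ∧ (x i + s i ≤ s z ∨ y q + s q ≤ y i) ∧ (s z ≤ y i ∨ y q + s q ≤ y i) ∧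
        y' i = y i - s q) := by
    intro i hi hiz hiq hip
    have := P.pos i hi
    simp only [hy', if_neg hiz]
    split_ifs with hlt
    · left
      rcases hrow i hi hiz with h | h
      · rcases hcol i hi hiq with h' | h' | h'
        · linarith
        · exact ⟨h', h, rfl⟩
        · linarith [P.pos q hq]
      · linarith
    · right
      refine ⟨not_lt.1 hlt, ?_, ?_, rfl⟩
      · rcases hcol i hi hiq with h' | h' | h'
        · exact Or.inl h'
        · linarith
        · exact Or.inr h'
      · rcases hrow i hi hiz with h | h
        · rcases hcol i hi hiq with h' | h' | h'
          · linarith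
          · linarith
          · exact Or.inr h'
        · exact Or.inl h
  have hsz : Function.update s z (2 * s z - L) z = 2 * s z - L := Function.update_self ..
  have hsn : ∀ i, i ≠ z → Function.update s z (2 * s z - L) i = s i :=
    fun i hi => Function.update_of_ne hi ..
  have hsepz : ∀ i ∈ S, i ≠ z → i ≠ q → i ≠ p → 2 * s z - L ≤ x' i ∨ 2 * s z - L ≤ y' i := by
    intro i hi hiz hiq hip
    rcases hrow i hi hiz with h | h
    · left
      rcases hX i hi hiz hiq hip with ⟨h1, h2, h3⟩ | ⟨h1, h2⟩
      · linarith [P.pos i hi]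
      · linarith
    · right
      rcases hY i hi hiz hiq hip with ⟨h1, h2, h3⟩ | ⟨h1, h2, h3, h4⟩
      · linarith [P.pos i hi]
      · linarith
  -- Horizontal separation survives the slides. Vertical separation can fail when `i` lies in the
  -- right strip below `q` and stays, while `j` lies over `z` and slides down. Then `j` ends up to
  -- the left of `i`, which is where `hle` enters: a tile over `z` left of `p` ends by `s z - s p`,
  -- and one right of `p` is moved there.
  have hsep : ∀ i ∈ S, ∀ j ∈ S, i ≠ j → i ≠ z → i ≠ q → i ≠ p → j ≠ z → j ≠ q → j ≠ p →
      (x i + s i ≤ x j → x' i + s i ≤ x' j) ∧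
      (y i + s i ≤ y j → y' i + s i ≤ y' j ∨ x' j + s j ≤ x' i) := by
    intro i hi j hj hij hiz hiq hip hjz hjq hjp
    have := P.pos i hi; have := P.pos j hj; have := P.pos p hp; have := P.pos q hq
    constructor
    · intro h
      rcases hX i hi hiz hiq hip with ⟨h1, h2, h3⟩ | ⟨h1, h2⟩ <;>
      rcases hX j hj hjz hjq hjp with ⟨k1, k2, k3⟩ | ⟨k1, k2⟩ <;> linarith
    · intro h
      rcases hY i hi hiz hiq hip with ⟨h1, h2, h3⟩ | ⟨h1, h2, h3, h4⟩ <;>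
      rcases hY j hj hjz hjq hjp with ⟨k1, k2, k3⟩ | ⟨k1, k2, k3, k4⟩
      · left; linarith
      · rcases k2 with k2 | k2
        · right
          rcases hX i hi hiz hiq hip with ⟨a1, a2, a3⟩ | ⟨a1, a2⟩ <;>
          rcases hX j hj hjz hjq hjp with ⟨b1, b2, b3⟩ | ⟨b1, b2⟩ <;> linarith
        · left; linarith
      · linarith
      · left; linarith
  refine ⟨x', y', ?_, ?_, ?_, ?_, ?_, ?_, ?_⟩
  · intro i hi
    obtain ⟨hi, hiq, hip, hiz⟩ := (hS' i).1 hi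
    by_cases h : i = z
    · rw [h, hsz]
      have := lt_of_le_of_ne hL2 (hiz h).symm
      linarith
    · rw [hsn i h]; exact P.pos i hi
  · intro i hi
    obtain ⟨hi, hiq, hip, hiz⟩ := (hS' i).1 hi
    by_cases h : i = z
    · rw [h, hxz']
    · have := P.x_nonneg i hi
      rcases hX i hi h hiq hip with ⟨h1, h2, h3⟩ | ⟨h1, h2⟩ <;> linarith
  · intro i hi
    obtain ⟨hi, hiq, hip, hiz⟩ := (hS' i).1 hi
    by_cases h : i = z
    · rw [h, hxz', hsz]; linarith [P.pos p hp]
    · rw [hsn i h]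
      have := P.x_le i hi
      rcases hX i hi h hiq hip with ⟨h1, h2, h3⟩ | ⟨h1, h2⟩ <;> linarith
  · intro i hi
    obtain ⟨hi, hiq, hip, hiz⟩ := (hS' i).1 hi
    by_cases h : i = z
    · rw [h, hyz']
    · have := P.y_nonneg i hi
      rcases hY i hi h hiq hip with ⟨h1, h2, h3⟩ | ⟨h1, h2, h3 | h3, h4⟩ <;> linarith
  · intro i hi
    obtain ⟨hi, hiq, hip, hiz⟩ := (hS' i).1 hi
    by_cases h : i = z
    · rw [h, hyz', hsz]; linarith [P.pos p hp]
    · rw [hsn i h]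
      have := P.y_le i hi
      rcases hY i hi h hiq hip with ⟨h1, h2, h3⟩ | ⟨h1, h2, h3, h4⟩ <;> linarith
  · intro i hi j hj hij
    obtain ⟨hi, hiq, hip, hiz⟩ := (hS' i).1 hi
    obtain ⟨hj, hjq, hjp, hjz⟩ := (hS' j).1 hj
    by_cases h : i = z
    · subst h
      rw [hsz, hxz', hyz', zero_add]
      rcases hsepz j hj hij.symm hjq hjp with h' | h'
      · exact Or.inl h'
      · exact Or.inr (Or.inr (Or.inl h'))
    by_cases h' : j = z
    · subst h'
      rw [hsz, hxz', hyz', zero_add]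
      rcases hsepz i hi hij hiq hip with h' | h'
      · exact Or.inr (Or.inl h')
      · exact Or.inr (Or.inr (Or.inr h'))
    rw [hsn i h, hsn j h']
    have h1 := hsep i hi j hj hij h hiq hip h' hjq hjp
    have h2 := hsep j hj i hi hij.symm h' hjq hjp h hiq hip
    rcases P.sep i hi j hj hij with h | h | h | h
    · exact Or.inl (h1.1 h)
    · exact Or.inr (Or.inl (h2.1 h))
    · rcases h1.2 h with h | h
      · exact Or.inr (Or.inr (Or.inl h))
      · exact Or.inr (Or.inl h)
    · rcases h2.2 h with h | h
      · exact Or.inr (Or.inr (Or.inr h))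
      · exact Or.inl h
  · have h3 := sum_erase_three hz hq hp hzq hzp hqp (fun i => s i ^ 2)
    rw [P.area] at h3
    have hrest : ∑ i ∈ ((S.erase q).erase p).erase z, Function.update s z (2 * s z - L) i ^ 2 =
        ∑ i ∈ ((S.erase q).erase p).erase z, s i ^ 2 :=
      Finset.sum_congr rfl fun i hi => by rw [hsn i (Finset.ne_of_mem_erase hi)]
    have hq' : s q = L - s z := by linarith
    have hp' : s p = L - s z := by linarith
    have hz' : z ∈ (S.erase q).erase p := Finset.mem_erase.2 ⟨hzp, Finset.mem_erase.2 ⟨hzq, hz⟩⟩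
    by_cases h0 : 2 * s z = L
    · have : S' = ((S.erase q).erase p).erase z := by
        ext i; rw [hS']; simp only [Finset.mem_erase]; tauto
      rw [this, hrest]
      rw [hq', hp', ← h0] at h3
      linarith
    · have : S' = (S.erase q).erase p := by
        ext i; rw [hS']; simp only [Finset.mem_erase]; tauto
      rw [this, ← Finset.add_sum_erase _ _ hz', hrest, hsz]
      rw [hq', hp'] at h3
      linarith

/-- The tiles `q` and `p` are disjoint, so they cannot both protrude into the upper right corner of
the L-shape. If `p` does not, `reduce_of_le` applies directly; if `q` does not, it applies to the
transposed packing. -/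
theorem reduce [DecidableEq ι] (P : FullPacking S x y s L) {z q p : ι} (hz : z ∈ S)
    (hq : q ∈ S) (hp : p ∈ S) (hzq : z ≠ q) (hzp : z ≠ p)
    (hxz : x z = 0) (hyz : y z = 0) (hxq : x q = s z) (hyq : y q < s z) (hyp : y p = s z)
    (hxp : x p < s z) (hsq : s z + s q = L) (hsp : s z + s p = L)
    {S' : Finset ι} (hS' : ∀ i, i ∈ S' ↔ i ∈ S ∧ i ≠ q ∧ i ≠ p ∧ (i = z → 2 * s z ≠ L)) :
    ∃ x' y', FullPacking S' x' y' (Function.update s z (2 * s z - L)) (s z) ∧ L ≤ 2 * s z := by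
  have hqp : q ≠ p := by rintro rfl; linarith
  have := P.pos q hq
  have := P.pos p hp
  have := P.x_nonneg p hp
  have := P.y_nonneg q hq
  rcases P.sep q hq p hp hqp with h | h | h | h
  · linarith
  · obtain ⟨x', y', h'⟩ := P.reduce_of_le hz hq hp hzq hzp hxz hyz hxq hyq hyp hxp hsq hsp
      (by linarith) hS'
    exact ⟨x', y', h', by linarith⟩
  · obtain ⟨x', y', h'⟩ := P.transpose.reduce_of_le hz hp hq hzp hzq hyz hxz hyp hxp hxq hyq hsp hsq
      (by linarith) (S' := S') (fun i => by rw [hS']; tauto)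
    exact ⟨y', x', h'.transpose, by linarith⟩
  · linarith

/-- A perfect packing of total length less than `3L` has total length `3L - 2u`, where all lengths
are multiples of `u`, and `L / u` is bounded below in terms of the number of tiles. -/
theorem structure_of_lt (n : ℕ) : ∀ (S : Finset ι) (x y s : ι → ℝ) (L : ℝ), S.card = n → 0 < L →
    FullPacking S x y s L → ∑ i ∈ S, s i < 3 * L →
    ∃ u : ℝ, 0 < u ∧ ∃ m : ℕ, L = m * u ∧ ∑ i ∈ S, s i = 3 * L - 2 * u ∧
      (∀ i ∈ S, ∃ c : ℕ, s i = c * u) ∧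
      (n = 1 ∨ 2 ≤ m ∧ n ≤ 2 * m ∧ (Odd n → n ≤ m + 3)) := by
  classical
  induction n using Nat.strong_induction_on with
  | _ n ih =>
  intro S x y s L hSn hL P hlt
  rcases Nat.lt_or_ge 1 n with hn | hn
  swap
  · have hS : S.Nonempty := by
      by_contra hS
      have := P.area
      rw [Finset.not_nonempty_iff_eq_empty.1 hS, Finset.sum_empty] at this
      exact absurd this.symm (pow_pos hL 2).ne'
    have hn1 : S.card = 1 := by have := hS.card_pos; omega
    obtain ⟨i, rfl⟩ := Finset.card_eq_one.1 hn1
    have hi := P.pos i (Finset.mem_singleton_self i)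
    have := P.area
    rw [Finset.sum_singleton] at this
    have hiL : s i = L := by
      rwa [sq_eq_sq₀ hi.le hL.le] at this
    refine ⟨L, hL, 1, by simp, by rw [Finset.sum_singleton, hiL]; ring, ?_, Or.inl (by omega)⟩
    intro j hj
    rw [Finset.mem_singleton.1 hj]
    exact ⟨1, by simpa using hiL⟩
  obtain ⟨x₁, y₁, P₁, z, hz, q, hq, p, hp, hzq, hzp, hxz, hyz, hxq, hyq, hyp, hxp, hsq, hsp⟩ :=
    P.exists_corner hL hlt (by omega)
  have hqp : q ≠ p := by rintro rfl; linarith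
  have hz0 := P.pos z hz
  have hq0 := P.pos q hq
  have h3 := sum_erase_three hz hq hp hzq hzp hqp s
  have hrest : ∑ i ∈ ((S.erase q).erase p).erase z, Function.update s z (2 * s z - L) i =
      ∑ i ∈ ((S.erase q).erase p).erase z, s i :=
    Finset.sum_congr rfl fun i hi => by
      rw [Function.update_of_ne (Finset.ne_of_mem_erase hi)]
  have hz' : z ∈ (S.erase q).erase p := Finset.mem_erase.2 ⟨hzp, Finset.mem_erase.2 ⟨hzq, hz⟩⟩
  have hp' : p ∈ S.erase q := Finset.mem_erase.2 ⟨hqp.symm, hp⟩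
  have hcard : ((S.erase q).erase p).card + 2 = n := by
    rw [← hSn, ← Finset.card_erase_add_one hq, ← Finset.card_erase_add_one hp']
  -- If `2 * s z = L`, the shrunken tile has side 0 and is dropped: `n` falls by 3 and `m` is
  -- halved. An odd `n` then leaves an even count, so the bound `n - 3 ≤ 2 (m / 2)` gives `n ≤ m +
  -- 3`.
  by_cases h0 : 2 * s z = L
  · have hcard' : (((S.erase q).erase p).erase z).card + 1 + 2 = n := by
      rw [Finset.card_erase_add_one hz', hcard]
    obtain ⟨x', y', P', -⟩ := P₁.reduce hz hq hp hzq hzp hxz hyz hxq hyq hyp hxp hsq hsp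
      (S' := ((S.erase q).erase p).erase z)
      (by intro i; simp only [Finset.mem_erase]; tauto)
    obtain ⟨u, hu, m, hm, hsum, hint, hnum⟩ := ih _ (by omega) _ _ _ _ _ rfl hz0 P'
      (by rw [hrest]; linarith)
    rw [hrest] at hsum
    have hm1 : m ≠ 0 := by
      rintro rfl
      simp [hm] at hz0
    refine ⟨u, hu, 2 * m, by push_cast; linarith, by linarith, ?_, Or.inr ⟨by omega, ?_, ?_⟩⟩
    · intro i hi
      by_cases hiz : i = z
      · exact ⟨m, by rw [hiz, hm]⟩
      by_cases hiq : i = q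
      · exact ⟨m, by rw [hiq, ← hm]; linarith⟩
      by_cases hip : i = p
      · exact ⟨m, by rw [hip, ← hm]; linarith⟩
      obtain ⟨c, hc⟩ := hint i (by simp only [Finset.mem_erase]; tauto)
      exact ⟨c, by rwa [Function.update_of_ne hiz] at hc⟩
    · rcases hnum with h | ⟨h1, h2, h4⟩ <;> omega
    · intro hodd
      have : n % 2 = 1 := Nat.odd_iff.1 hodd
      rcases hnum with h | ⟨h1, h2, h4⟩ <;> omega
  · obtain ⟨x', y', P', hle⟩ := P₁.reduce hz hq hp hzq hzp hxz hyz hxq hyq hyp hxp hsq hsp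
      (S' := (S.erase q).erase p)
      (by intro i; simp only [Finset.mem_erase]; tauto)
    have hsum' := Finset.add_sum_erase _ (Function.update s z (2 * s z - L)) hz'
    rw [hrest, Function.update_self] at hsum'
    obtain ⟨u, hu, m, hm, hsum, hint, hnum⟩ := ih _ (by omega) _ _ _ _ _ rfl hz0 P'
      (by rw [← hsum']; linarith)
    obtain ⟨c, hc⟩ := hint z hz'
    rw [Function.update_self] at hc
    have hcm : c < m := by
      have : (c : ℝ) * u < m * u := by rw [← hc, ← hm]; linarith
      exact_mod_cast lt_of_mul_lt_mul_right this hu.le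
    -- The border has width `(w + 1) u`, and `m` grows by `w + 1` when two tiles are put back.
    obtain ⟨w, rfl⟩ := Nat.exists_eq_add_of_lt hcm
    have hw : s q = ((w + 1 : ℕ) : ℝ) * u := by push_cast at hm ⊢; linarith
    have hLm : L = ((c + 2 * (w + 1) : ℕ) : ℝ) * u := by push_cast at hm hw ⊢; linarith
    have hall : ∀ i ∈ S, ∃ c : ℕ, s i = c * u := by
      intro i hi
      by_cases hiz : i = z
      · exact ⟨_, by rw [hiz]; exact hm⟩
      by_cases hiq : i = q
      · exact ⟨_, by rw [hiq]; exact hw⟩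
      by_cases hip : i = p
      · exact ⟨_, by rw [hip, ← hw]; linarith⟩
      obtain ⟨c, hc⟩ := hint i (by simp only [Finset.mem_erase]; tauto)
      exact ⟨c, by rwa [Function.update_of_ne hiz] at hc⟩
    -- A single remaining tile would be the shrunken `z` filling its own old square, forcing `s z =
    -- L`.
    have hcard1 : ((S.erase q).erase p).card ≠ 1 := by
      intro h1
      obtain ⟨i, hi⟩ := Finset.card_eq_one.1 h1
      have hiz : z = i := by rw [hi] at hz'; exact Finset.mem_singleton.1 hz'
      subst hiz
      have := P'.area
      rw [hi, Finset.sum_singleton, Function.update_self,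
        sq_eq_sq₀ (by linarith) hz0.le] at this
      linarith
    obtain ⟨h1, h2, h4⟩ := hnum.resolve_left hcard1
    refine ⟨u, hu, _, hLm, by linarith, hall, Or.inr ⟨by omega, by omega, fun hodd => ?_⟩⟩
    -- The odd bound needs `m` to grow by at least 2. If it grows by 1, the border has width `u`, so
    -- every tile other than `z` has side exactly `u`. The area then gives `(c + 2)² - (c + 1)² = 2c
    -- + 3` such tiles, making `n` even.
    rcases Nat.eq_zero_or_pos w with rfl | hw0
    · exfalso
      have hu' : s q = u := by simpa using hw
      have hone : ∀ i ∈ S.erase z, s i ^ 2 = u ^ 2 := by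
        intro i hi
        obtain ⟨hiz, hi⟩ := Finset.mem_erase.1 hi
        obtain ⟨d, hd⟩ := hall i hi
        have hpos := P.pos i hi
        have hd0 : 1 ≤ d := by
          rcases Nat.eq_zero_or_pos d with rfl | h
          · simp [hd] at hpos
          · exact h
        have hge : u ≤ s i := by
          rw [hd]
          have : (1 : ℝ) ≤ d := by exact_mod_cast hd0
          nlinarith
        have hle : s i ≤ u := by
          have := P₁.x_nonneg i hi; have := P₁.x_le i hi
          have := P₁.y_nonneg i hi; have := P₁.y_le i hi
          rcases P₁.sep i hi z hz hiz with h | h | h | h <;> linarith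
        rw [le_antisymm hle hge]
      have harea := P.area
      rw [← Finset.add_sum_erase _ _ hz, Finset.sum_congr rfl hone, Finset.sum_const,
        nsmul_eq_mul] at harea
      have hcz := Finset.card_erase_add_one hz
      rw [hm, hLm] at harea
      have hu2 : (u ^ 2) ≠ 0 := (pow_pos hu 2).ne'
      have key : ((c + 0 + 1 : ℕ) : ℝ) ^ 2 + ((S.erase z).card : ℝ) =
          ((c + 2 * (0 + 1) : ℕ) : ℝ) ^ 2 := by
        apply mul_right_cancel₀ hu2
        linarith
      have key' : (c + 0 + 1) ^ 2 + (S.erase z).card = (c + 2 * (0 + 1)) ^ 2 := by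
        exact_mod_cast key
      have : (S.erase z).card = 2 * c + 3 := by nlinarith
      have := Nat.odd_iff.1 hodd
      omega
    · have := h4 (by
        rw [Nat.odd_iff] at hodd ⊢; omega)
      omega

/-- The lower bounds for the total length of a perfect packing of the unit square. -/
theorem le_sum_of_card_even (P : FullPacking S x y s 1) {k : ℕ} (hk : 1 ≤ k)
    (hS : S.card = 2 * k) : 3 - 2 / (k : ℝ) ≤ ∑ i ∈ S, s i := by
  have hk0 : (0 : ℝ) < k := by exact_mod_cast hk
  rcases le_or_gt (3 * 1) (∑ i ∈ S, s i) with h | h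
  · have : 0 ≤ 2 / (k : ℝ) := by positivity
    linarith
  obtain ⟨u, hu, m, hm, hsum, -, hnum⟩ := structure_of_lt _ S x y s 1 rfl one_pos P h
  have hkm : (k : ℝ) ≤ m := by
    have : k ≤ m := by omega
    exact_mod_cast this
  have : 1 / (k : ℝ) ≥ u := by
    rw [ge_iff_le, le_div_iff₀ hk0]
    nlinarith
  rw [hsum]
  have h2 : 2 / (k : ℝ) = 2 * (1 / k) := by ring
  linarith

/-- The odd bound reads `2 * k + 3 ≤ m + 3`, so `2 * u ≤ 1 / k`. -/
theorem le_sum_of_card_odd (P : FullPacking S x y s 1) {k : ℕ} (hk : 1 ≤ k)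
    (hS : S.card = 2 * k + 3) : 3 - 1 / (k : ℝ) ≤ ∑ i ∈ S, s i := by
  have hk0 : (0 : ℝ) < k := by exact_mod_cast hk
  rcases le_or_gt (3 * 1) (∑ i ∈ S, s i) with h | h
  · have : 0 ≤ 1 / (k : ℝ) := by positivity
    linarith
  obtain ⟨u, hu, m, hm, hsum, -, hnum⟩ := structure_of_lt _ S x y s 1 rfl one_pos P h
  have hkm : 2 * (k : ℝ) ≤ m := by
    have hodd : Odd S.card := ⟨k + 1, by omega⟩
    have : 2 * k ≤ m := by
      rcases hnum with h | ⟨-, -, h⟩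
      · omega
      · have := h hodd; omega
    exact_mod_cast this
  have : 1 / (k : ℝ) ≥ 2 * u := by
    rw [ge_iff_le, le_div_iff₀ hk0]
    nlinarith
  rw [hsum]
  linarith

end FullPacking

/-! ### Coordinates in a square, and the exclusion of tilted tiles. -/

namespace PlaneSquare

/-- The coordinates of a point relative to the corner and the sides of the square. -/
def coordU (Q : PlaneSquare) (p : ℝ × ℝ) : ℝ :=
  (p.1 - Q.corner.1) * Q.dir.1 + (p.2 - Q.corner.2) * Q.dir.2

def coordV (Q : PlaneSquare) (p : ℝ × ℝ) : ℝ :=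
  (p.2 - Q.corner.2) * Q.dir.1 - (p.1 - Q.corner.1) * Q.dir.2

theorem continuous_coordU (Q : PlaneSquare) : Continuous Q.coordU := by
  unfold coordU; fun_prop

theorem continuous_coordV (Q : PlaneSquare) : Continuous Q.coordV := by
  unfold coordV; fun_prop

theorem mem_carrier_iff (Q : PlaneSquare) (p : ℝ × ℝ) :
    p ∈ Q.carrier ↔ Q.coordU p ∈ Icc 0 Q.side ∧ Q.coordV p ∈ Icc 0 Q.side := by
  have h := Q.dir_unit
  constructor
  · rintro ⟨u, hu, v, hv, rfl⟩
    have h1 : Q.coordU (Q.corner.1 + u * Q.dir.1 - v * Q.dir.2,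
        Q.corner.2 + u * Q.dir.2 + v * Q.dir.1) = u := by
      simp only [coordU]; linear_combination u * h
    have h2 : Q.coordV (Q.corner.1 + u * Q.dir.1 - v * Q.dir.2,
        Q.corner.2 + u * Q.dir.2 + v * Q.dir.1) = v := by
      simp only [coordV]; linear_combination v * h
    rw [h1, h2]
    exact ⟨hu, hv⟩
  · rintro ⟨hu, hv⟩
    refine ⟨_, hu, _, hv, Prod.ext ?_ ?_⟩
    · simp only [coordU, coordV]; linear_combination (Q.corner.1 - p.1) * h
    · simp only [coordU, coordV]; linear_combination (Q.corner.2 - p.2) * h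

theorem isClosed_carrier (Q : PlaneSquare) : IsClosed Q.carrier := by
  have : Q.carrier = Q.coordU ⁻¹' Icc 0 Q.side ∩ Q.coordV ⁻¹' Icc 0 Q.side := by
    ext p; exact Q.mem_carrier_iff p
  rw [this]
  exact (isClosed_Icc.preimage Q.continuous_coordU).inter
    (isClosed_Icc.preimage Q.continuous_coordV)

theorem mem_interior_carrier (Q : PlaneSquare) {p : ℝ × ℝ} (hu : Q.coordU p ∈ Ioo 0 Q.side)
    (hv : Q.coordV p ∈ Ioo 0 Q.side) : p ∈ interior Q.carrier := by
  refine mem_interior.2 ⟨Q.coordU ⁻¹' Ioo 0 Q.side ∩ Q.coordV ⁻¹' Ioo 0 Q.side, ?_, ?_, hu, hv⟩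
  · rintro p ⟨h1, h2⟩
    exact (Q.mem_carrier_iff p).2 ⟨Ioo_subset_Icc_self h1, Ioo_subset_Icc_self h2⟩
  · exact (isOpen_Ioo.preimage Q.continuous_coordU).inter
      (isOpen_Ioo.preimage Q.continuous_coordV)

/-- The axis-parallel square with lower left corner `(a, b)`. -/
def axis (a b t : ℝ) (ht : 0 < t) : PlaneSquare := ⟨(a, b), (1, 0), t, by norm_num, ht⟩

theorem carrier_axis (a b t : ℝ) (ht : 0 < t) :
    (axis a b t ht).carrier = Icc a (a + t) ×ˢ Icc b (b + t) := by
  ext p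
  rw [mem_carrier_iff]
  simp only [axis, coordU, coordV, mem_Icc, mem_prod, mul_one, mul_zero, add_zero, sub_zero]
  constructor <;> rintro ⟨⟨h1, h2⟩, h3, h4⟩ <;> refine ⟨⟨?_, ?_⟩, ?_, ?_⟩ <;> linarith

/-- The same square, with the next corner in counterclockwise order as its base corner. -/
def turn (Q : PlaneSquare) : PlaneSquare where
  corner := (Q.corner.1 + Q.side * Q.dir.1, Q.corner.2 + Q.side * Q.dir.2)
  dir := (-Q.dir.2, Q.dir.1)
  side := Q.side
  dir_unit := by have := Q.dir_unit; simp only; linarith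
  side_pos := Q.side_pos

theorem carrier_turn (Q : PlaneSquare) : Q.turn.carrier = Q.carrier := by
  have h := Q.dir_unit
  ext p
  have h1 : Q.turn.coordU p = Q.coordV p := by
    simp only [turn, coordU, coordV]; ring
  have h2 : Q.turn.coordV p = Q.side - Q.coordU p := by
    simp only [turn, coordU, coordV]; linear_combination Q.side * h
  rw [mem_carrier_iff, mem_carrier_iff, h1, h2, show Q.turn.side = Q.side from rfl]
  simp only [mem_Icc]
  constructor <;> rintro ⟨⟨h1, h2⟩, h3, h4⟩ <;> refine ⟨⟨?_, ?_⟩, ?_, ?_⟩ <;> linarith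

/-- Every square can be based at its lowest corner, the left one if there are two. -/
theorem exists_dir_pos (Q : PlaneSquare) :
    ∃ Q' : PlaneSquare, Q'.carrier = Q.carrier ∧ Q'.side = Q.side ∧ 0 < Q'.dir.1 ∧ 0 ≤ Q'.dir.2 := by
  have h := Q.dir_unit
  rcases lt_trichotomy Q.dir.1 0 with h1 | h1 | h1 <;>
  rcases lt_trichotomy Q.dir.2 0 with h2 | h2 | h2
  case inl.inl | inl.inr.inl =>
    refine ⟨Q.turn.turn, by rw [carrier_turn, carrier_turn], rfl, ?_, ?_⟩ <;>
      simp only [turn] <;> linarith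
  case inl.inr.inr | inr.inl.inr.inr =>
    refine ⟨Q.turn.turn.turn, by rw [carrier_turn, carrier_turn, carrier_turn], rfl, ?_, ?_⟩ <;>
      simp only [turn] <;> linarith
  case inr.inl.inl | inr.inr.inl =>
    refine ⟨Q.turn, Q.carrier_turn, rfl, ?_, ?_⟩ <;> simp only [turn] <;> linarith
  case inr.inl.inr.inl => rw [h1, h2] at h; norm_num at h
  case inr.inr.inr.inl | inr.inr.inr.inr => exact ⟨Q, rfl, rfl, h1, by linarith⟩

open Filter Topology in
theorem eventually_lt_of_continuous {f : ℝ → ℝ} (hf : Continuous f) {c : ℝ} (h : f 0 < c) :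
    ∀ᶠ t in 𝓝[>] (0 : ℝ), f t < c :=
  ((hf.tendsto 0).eventually (gt_mem_nhds h)).filter_mono nhdsWithin_le_nhds

open Filter Topology in
/-- In a tiling of the unit square by squares no tile is tilted. -/
theorem dir_snd_eq_zero {ι : Type*} [Fintype ι] {T : ι → PlaneSquare}
    (hcov : (⋃ i, (T i).carrier) = unitSquareRegion)
    (hdisj : ∀ i j, i ≠ j → Disjoint (interior (T i).carrier) (interior (T j).carrier))
    (hdir : ∀ i, 0 < (T i).dir.1 ∧ 0 ≤ (T i).dir.2) (i₀ : ι) : (T i₀).dir.2 = 0 := by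
  classical
  by_contra hne
  -- Among the tilted tiles take one whose lowest corner `V` is lowest. The contradiction comes from
  -- the wedge to the right of `V`, under the rising edge of this tile.
  obtain ⟨i, hi, hmin⟩ := (Finset.univ.filter fun i => 0 < (T i).dir.2).exists_min_image
    (fun i => (T i).corner.2) ⟨i₀, by simpa using lt_of_le_of_ne (hdir i₀).2 (Ne.symm hne)⟩
  have hd2 : 0 < (T i).dir.2 := (Finset.mem_filter.1 hi).2
  have hd1 := (hdir i).1
  have hs := (T i).side_pos
  have hunit := (T i).dir_unit
  set V := (T i).corner with hV
  have hsub : ∀ j, (T j).carrier ⊆ unitSquareRegion := fun j =>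
    hcov ▸ subset_iUnion (fun j => (T j).carrier) j
  have hV0 : V ∈ unitSquareRegion := hsub i <| ((T i).mem_carrier_iff V).2 <| by
    simp [coordU, coordV, ← hV, hs.le]
  have hV1 : (V.1 + (T i).side * (T i).dir.1 - 0 * (T i).dir.2,
      V.2 + (T i).side * (T i).dir.2 + 0 * (T i).dir.1) ∈ unitSquareRegion :=
    hsub i ⟨(T i).side, ⟨hs.le, le_rfl⟩, 0, ⟨le_rfl, hs.le⟩, rfl⟩
  have hlt1 : V.1 < 1 := by
    have : V.1 + (T i).side * (T i).dir.1 - 0 * (T i).dir.2 ≤ 1 := hV1.1.2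
    nlinarith [mul_pos hs hd1]
  have hlt2 : V.2 < 1 := by
    have : V.2 + (T i).side * (T i).dir.2 + 0 * (T i).dir.1 ≤ 1 := hV1.2.2
    nlinarith [mul_pos hs hd2]
  have hpos : ∀ᶠ t in 𝓝[>] (0 : ℝ), 0 < t := self_mem_nhdsWithin
  -- The parabola through `V` enters that wedge: near `V` it runs above the horizontal through `V`
  -- and below every rising line through `V`. Finitely many closed tiles cover it, so one tile `j`
  -- contains points of it arbitrarily near `V`, and `V` itself.
  have hev : ∀ᶠ t in 𝓝[>] (0 : ℝ), ∃ j, (V.1 + t, V.2 + t ^ 2) ∈ (T j).carrier := by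
    filter_upwards [hpos,
      eventually_lt_of_continuous (f := fun t => V.1 + t) (by fun_prop) (c := 1) (by simpa),
      eventually_lt_of_continuous (f := fun t => V.2 + t ^ 2) (by fun_prop) (c := 1) (by simpa)]
      with t h0 h1 h2
    have : (V.1 + t, V.2 + t ^ 2) ∈ unitSquareRegion :=
      ⟨⟨by have := hV0.1.1; simp only; linarith, h1.le⟩,
        ⟨by have := hV0.2.1; simp only; nlinarith, h2.le⟩⟩
    rw [← hcov] at this
    exact mem_iUnion.1 this
  obtain ⟨j, hj⟩ : ∃ j, ∃ᶠ t in 𝓝[>] (0 : ℝ), (V.1 + t, V.2 + t ^ 2) ∈ (T j).carrier := by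
    by_contra! hno
    have : ∀ᶠ t in 𝓝[>] (0 : ℝ), ∀ j, (V.1 + t, V.2 + t ^ 2) ∉ (T j).carrier :=
      eventually_all.2 hno
    obtain ⟨t, ⟨k, hk⟩, ht⟩ := (hev.and this).exists
    exact ht k hk
  have hVj : V ∈ (T j).carrier := by
    by_contra hVj
    have hc : Continuous fun t : ℝ => (V.1 + t, V.2 + t ^ 2) := by fun_prop
    have hmem : (fun t : ℝ => (V.1 + t, V.2 + t ^ 2)) 0 ∈ (T j).carrierᶜ := by simpa using hVj
    have := ((hc.tendsto 0).eventually ((T j).isClosed_carrier.isOpen_compl.mem_nhds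
      hmem)).filter_mono (nhdsWithin_le_nhds (s := Ioi 0))
    exact hj this
  obtain ⟨⟨hU0, hU1⟩, hW0, hW1⟩ := ((T j).mem_carrier_iff V).1 hVj
  have hjunit := (T j).dir_unit
  obtain ⟨hj1, hj2⟩ := hdir j
  rcases hj2.lt_or_eq with hj2 | hj2
  -- If `j` is tilted, minimality puts `V` on the lower right edge line of `j`, and the parabola
  -- leaves `j` beneath that rising edge.
  · have hm : V.2 ≤ (T j).corner.2 := hmin j (by simpa using hj2)
    have hid : V.2 - (T j).corner.2 =
        (T j).coordU V * (T j).dir.2 + (T j).coordV V * (T j).dir.1 := by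
      simp only [coordU, coordV]; linear_combination ((T j).corner.2 - V.2) * hjunit
    have hW : (T j).coordV V ≤ 0 := by
      by_contra! hW
      nlinarith [mul_pos hW hj1, mul_nonneg hU0 hj2.le]
    obtain ⟨t, ht, h0, h1⟩ := (hj.and_eventually (hpos.and (eventually_lt_of_continuous
      (f := fun t => t * (T j).dir.1) (by fun_prop) (c := (T j).dir.2) (by simpa)))).exists
    have h2 := (((T j).mem_carrier_iff _).1 ht).2.1
    have h3 : (T j).coordV (V.1 + t, V.2 + t ^ 2) =
        (T j).coordV V + t * (t * (T j).dir.1 - (T j).dir.2) := by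
      simp only [coordV]; ring
    rw [h3] at h2
    nlinarith [mul_pos h0 (sub_pos.2 h1)]
  -- If `j` is not tilted, it contains a small square with lower left corner `V`, which overlaps the
  -- interior of tile `i`. The common interior point is `V + r (dir + (0, 1))` for small `r`, with
  -- coordinates `r (1 + dir.2)` and `r dir.1` in tile `i`.
  · have hij : i ≠ j := by
      rintro rfl
      exact hd2.ne hj2
    have hj1' : (T j).dir.1 = 1 := by
      rw [← hj2] at hjunit
      nlinarith
    obtain ⟨t, ht, h0⟩ := (hj.and_eventually hpos).exists
    obtain ⟨⟨-, h1⟩, -, h2⟩ := ((T j).mem_carrier_iff _).1 ht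
    simp only [coordU, coordV, ← hj2, hj1', mul_one, mul_zero, add_zero, sub_zero]
      at h1 h2 hU0 hW0
    have hsq := pow_pos h0 2
    obtain ⟨r, hr0, hr1, hr2, hr3, hr4⟩ := (hpos.and
      ((eventually_lt_of_continuous (f := fun r => r * (1 + (T i).dir.2)) (by fun_prop)
        (c := (T i).side) (by simpa)).and
      ((eventually_lt_of_continuous (f := fun r => r * (T i).dir.1) (by fun_prop)
        (c := (T i).side) (by simpa)).and
      ((eventually_lt_of_continuous (f := fun r => V.1 + r * (T i).dir.1) (by fun_prop)
        (c := (T j).corner.1 + (T j).side) (by simp; linarith)).and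
      (eventually_lt_of_continuous (f := fun r => V.2 + r * (1 + (T i).dir.2)) (by fun_prop)
        (c := (T j).corner.2 + (T j).side) (by simp; linarith)))))).exists
    have hp1 : 0 < r * (T i).dir.1 := by positivity
    have hp2 : 0 < r * (1 + (T i).dir.2) := by positivity
    refine Set.disjoint_left.1 (hdisj i j hij)
      (show (V.1 + r * (T i).dir.1, V.2 + r * (1 + (T i).dir.2)) ∈ _ from
        (T i).mem_interior_carrier ?_ ?_) ((T j).mem_interior_carrier ?_ ?_)
    · have : (T i).coordU (V.1 + r * (T i).dir.1, V.2 + r * (1 + (T i).dir.2)) =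
          r * (1 + (T i).dir.2) := by
        simp only [coordU, ← hV]; linear_combination r * hunit
      rw [this]; exact ⟨hp2, hr1⟩
    · have : (T i).coordV (V.1 + r * (T i).dir.1, V.2 + r * (1 + (T i).dir.2)) =
          r * (T i).dir.1 := by
        simp only [coordV, ← hV]; ring
      rw [this]; exact ⟨hp1, hr2⟩
    · simp only [coordU, ← hj2, hj1', mul_one, mul_zero, add_zero, mem_Ioo]
      constructor <;> linarith
    · simp only [coordV, ← hj2, hj1', mul_one, mul_zero, sub_zero, mem_Ioo]
      constructor <;> linarith

theorem carrier_of_dir {Q : PlaneSquare} (h1 : 0 < Q.dir.1) (h2 : Q.dir.2 = 0) :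
    Q.carrier = Icc Q.corner.1 (Q.corner.1 + Q.side) ×ˢ Icc Q.corner.2 (Q.corner.2 + Q.side) := by
  have h := Q.dir_unit
  have h1' : Q.dir.1 = 1 := by
    rw [h2] at h
    nlinarith
  rw [← carrier_axis _ _ _ Q.side_pos]
  ext p
  rw [mem_carrier_iff, mem_carrier_iff]
  simp [coordU, coordV, axis, h1', h2]

end PlaneSquare

/-! ### Passage between tilings and packings. -/

open MeasureTheory in
/-- A tiling of the unit square is a perfect packing by axis-parallel squares. -/
theorem IsSquareTiling.exists_fullPacking {n : ℕ} {T : Fin n → PlaneSquare}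
    (hT : IsSquareTiling T) :
    ∃ x y : Fin n → ℝ, FullPacking Finset.univ x y (fun i => (T i).side) 1 := by
  choose Q hQc hQs hQ1 hQ2 using fun i => (T i).exists_dir_pos
  have hcov : (⋃ i, (Q i).carrier) = unitSquareRegion := by
    simp only [hQc]; exact hT.1
  have hdisj : ∀ i j, i ≠ j → Disjoint (interior (Q i).carrier) (interior (Q j).carrier) := by
    simp only [hQc]; exact hT.2
  have hdir := PlaneSquare.dir_snd_eq_zero hcov hdisj fun i => ⟨hQ1 i, hQ2 i⟩
  have hbox : ∀ i, (Q i).carrier = Icc (Q i).corner.1 ((Q i).corner.1 + (T i).side) ×ˢ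
      Icc (Q i).corner.2 ((Q i).corner.2 + (T i).side) := fun i => by
    rw [PlaneSquare.carrier_of_dir (hQ1 i) (hdir i), hQs]
  have hint : ∀ i, interior (Q i).carrier =
      Ioo (Q i).corner.1 ((Q i).corner.1 + (T i).side) ×ˢ
      Ioo (Q i).corner.2 ((Q i).corner.2 + (T i).side) := fun i => by
    rw [hbox, interior_prod_eq, interior_Icc, interior_Icc]
  have hpos := fun i => (T i).side_pos
  have hsub : ∀ i, (Q i).carrier ⊆ unitSquareRegion := fun i =>
    hcov ▸ subset_iUnion (fun i => (Q i).carrier) i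
  have hlo : ∀ i, ((Q i).corner.1, (Q i).corner.2) ∈ unitSquareRegion := fun i => hsub i <| by
    rw [hbox]
    exact ⟨⟨le_rfl, by simp [(hpos i).le]⟩, ⟨le_rfl, by simp [(hpos i).le]⟩⟩
  have hhi : ∀ i, ((Q i).corner.1 + (T i).side, (Q i).corner.2 + (T i).side) ∈ unitSquareRegion :=
    fun i => hsub i <| by
      rw [hbox]
      exact ⟨⟨by simp [(hpos i).le], le_rfl⟩, ⟨by simp [(hpos i).le], le_rfl⟩⟩
  refine ⟨fun i => (Q i).corner.1, fun i => (Q i).corner.2, fun i _ => hpos i,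
    fun i _ => (hlo i).1.1, fun i _ => (hhi i).1.2, fun i _ => (hlo i).2.1, fun i _ => (hhi i).2.2,
    ?_, ?_⟩
  · intro i _ j _ hij
    have h := hdisj i j hij
    rw [hint, hint, disjoint_prod, Ioo_disjoint_Ioo, Ioo_disjoint_Ioo] at h
    have := hpos i; have := hpos j
    rcases h with h | h
    · rcases min_le_iff.1 h with h | h <;> rcases le_max_iff.1 h with h | h
      · linarith
      · exact Or.inl h
      · exact Or.inr (Or.inl h)
      · linarith
    · rcases min_le_iff.1 h with h | h <;> rcases le_max_iff.1 h with h | h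
      · linarith
      · exact Or.inr (Or.inr (Or.inl h))
      · exact Or.inr (Or.inr (Or.inr h))
      · linarith
  · have hunit : volume unitSquareRegion = 1 := by
      simpa [unitSquareRegion] using FullPacking.volume_closedBox 0 0 1 zero_le_one
    have hle : (1 : ENNReal) ≤ ENNReal.ofReal (∑ i, (T i).side ^ 2) := by
      rw [← hunit, ← hcov, ENNReal.ofReal_sum_of_nonneg fun i _ => sq_nonneg _]
      refine (measure_iUnion_fintype_le volume _).trans (Finset.sum_le_sum fun i _ => ?_)
      rw [hbox, FullPacking.volume_closedBox _ _ _ (hpos i).le]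
    have hge : ENNReal.ofReal (∑ i, (T i).side ^ 2) ≤ 1 := by
      rw [ENNReal.ofReal_sum_of_nonneg fun i _ => sq_nonneg _]
      have : ∑ i, ENNReal.ofReal ((T i).side ^ 2) = volume (⋃ i, interior (Q i).carrier) := by
        rw [measure_iUnion (fun i j hij => hdisj i j hij)
          fun i => isOpen_interior.measurableSet, tsum_fintype]
        refine Finset.sum_congr rfl fun i _ => ?_
        rw [hint, FullPacking.volume_openBox _ _ _ (hpos i).le]
      rw [this, ← hunit]
      exact measure_mono (iUnion_subset fun i => interior_subset.trans (hsub i))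
    have h0 : 0 ≤ ∑ i, (T i).side ^ 2 := Finset.sum_nonneg fun i _ => sq_nonneg _
    rw [one_pow]
    exact le_antisymm (by simpa using hge) (by simpa using hle)

/-- A perfect packing of the unit square gives a tiling with the same side lengths. -/
theorem FullPacking.exists_isSquareTiling {ι : Type*} [Fintype ι] {x y s : ι → ℝ}
    (P : FullPacking Finset.univ x y s 1) {n : ℕ} (hn : Fintype.card ι = n) :
    ∃ T : Fin n → PlaneSquare, IsSquareTiling T ∧
      sideLengths T = Finset.univ.val.map s := by
  obtain ⟨e⟩ : Nonempty (Fin n ≃ ι) := ⟨(Fintype.equivFinOfCardEq hn).symm⟩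
  have hpos : ∀ i, 0 < s i := fun i => P.pos i (Finset.mem_univ _)
  refine ⟨fun k => .axis (x (e k)) (y (e k)) (s (e k)) (hpos _), ⟨?_, ?_⟩, ?_⟩
  · ext ⟨X, Y⟩
    simp only [PlaneSquare.carrier_axis, mem_iUnion, unitSquareRegion]
    constructor
    · rintro ⟨k, ⟨h1, h2⟩, h3, h4⟩
      have hk := Finset.mem_univ (e k)
      exact ⟨⟨(P.x_nonneg _ hk).trans h1, h2.trans (P.x_le _ hk)⟩,
        ⟨(P.y_nonneg _ hk).trans h3, h4.trans (P.y_le _ hk)⟩⟩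
    · rintro ⟨hX, hY⟩
      obtain ⟨i, -, h⟩ := P.cover one_pos hX hY
      exact ⟨e.symm i, by rw [e.apply_symm_apply]; exact h⟩
  · intro k l hkl
    simp only [PlaneSquare.carrier_axis, interior_prod_eq, interior_Icc]
    exact P.disjoint_openBox (Finset.mem_univ _) (Finset.mem_univ _) (e.injective.ne hkl)
  · have : sideLengths (fun k => PlaneSquare.axis (x (e k)) (y (e k)) (s (e k)) (hpos _)) =
        (Finset.univ.val.map e).map s := by
      rw [Multiset.map_map]; rfl
    rw [this]
    congr 1
    exact congrArg Finset.val (Finset.map_univ_equiv e)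

theorem sum_sideLengths {n : ℕ} (T : Fin n → PlaneSquare) :
    (sideLengths T).sum = totalLength T := rfl

/-! ### The extremal tilings. -/

theorem nat_mul_add_le {i j : ℕ} (h : i < j) {v : ℝ} (hv : 0 ≤ v) : (i : ℝ) * v + v ≤ j * v := by
  have : (i : ℝ) + 1 ≤ j := by exact_mod_cast h
  nlinarith

/-- The unit square can be tiled by a square of side `r u`, where `u = 1 / (r + 1)`, bordered by
`2 r` squares of side `u`, and `m²` squares of side `u / m` in the remaining corner. -/
theorem exists_bordered_tiling (r m n : ℕ) (hr : 0 < r) (hm : 0 < m) (hn : n = 2 * r + m ^ 2 + 1)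
    {u v : ℝ} (hu : (r + 1) * u = 1) (hv : m * v = u) :
    ∃ T : Fin n → PlaneSquare, IsSquareTiling T ∧
      sideLengths T = {r * u} + Multiset.replicate (2 * r) u + Multiset.replicate (m ^ 2) v := by
  have hr0 : (0 : ℝ) < r := by exact_mod_cast hr
  have hm0 : (0 : ℝ) < m := by exact_mod_cast hm
  have hu0 : 0 < u := by
    by_contra! h
    nlinarith
  have hv0 : 0 < v := by
    by_contra! h
    nlinarith
  have hru : 0 < r * u := by positivity
  -- `none` is the big tile, the two copies of `Fin r` are the top row and the right column, and
  -- `Fin m × Fin m` is the grid in the corner.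
  let x : Option ((Fin r ⊕ Fin r) ⊕ (Fin m × Fin m)) → ℝ := fun o => o.elim 0
    (Sum.elim (Sum.elim (fun j => (j : ℕ) * u) fun _ => r * u) fun c => r * u + (c.1 : ℕ) * v)
  let y : Option ((Fin r ⊕ Fin r) ⊕ (Fin m × Fin m)) → ℝ := fun o => o.elim 0
    (Sum.elim (Sum.elim (fun _ => r * u) fun j => (j : ℕ) * u) fun c => r * u + (c.2 : ℕ) * v)
  let s : Option ((Fin r ⊕ Fin r) ⊕ (Fin m × Fin m)) → ℝ := fun o => o.elim (r * u)
    (Sum.elim (fun _ => u) fun _ => v)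
  have hrow : ∀ j : Fin r, 0 ≤ ((j : ℕ) : ℝ) * u ∧ ((j : ℕ) : ℝ) * u + u ≤ r * u := fun j =>
    ⟨by positivity, nat_mul_add_le j.2 hu0.le⟩
  have hsub : ∀ j : Fin m, 0 ≤ ((j : ℕ) : ℝ) * v ∧ ((j : ℕ) : ℝ) * v + v ≤ u := fun j =>
    ⟨by positivity, hv ▸ nat_mul_add_le j.2 hv0.le⟩
  have P : FullPacking Finset.univ x y s 1 := by
    refine ⟨?_, ?_, ?_, ?_, ?_, ?_, ?_⟩
    · rintro (_ | (_ | _) | _) - <;> simp only [s, Option.elim, Sum.elim_inl, Sum.elim_inr] <;>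
        assumption
    · rintro (_ | (j | _) | ⟨a, b⟩) - <;> simp only [x, Option.elim, Sum.elim_inl, Sum.elim_inr]
      · exact le_rfl
      · exact (hrow j).1
      · exact hru.le
      · linarith [(hsub a).1]
    · rintro (_ | (j | _) | ⟨a, b⟩) - <;>
        simp only [x, s, Option.elim, Sum.elim_inl, Sum.elim_inr]
      · linarith
      · linarith [(hrow j).2]
      · linarith
      · linarith [(hsub a).2]
    · rintro (_ | (_ | j) | ⟨a, b⟩) - <;> simp only [y, Option.elim, Sum.elim_inl, Sum.elim_inr]
      · exact le_rfl
      · exact hru.le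
      · exact (hrow j).1
      · linarith [(hsub b).1]
    · rintro (_ | (_ | j) | ⟨a, b⟩) - <;>
        simp only [y, s, Option.elim, Sum.elim_inl, Sum.elim_inr]
      · linarith
      · linarith
      · linarith [(hrow j).2]
      · linarith [(hsub b).2]
    · have hne : ∀ {t : ℝ} {l : ℕ} (i j : Fin l), 0 ≤ t → i ≠ j →
          ((i : ℕ) : ℝ) * t + t ≤ (j : ℕ) * t ∨ ((j : ℕ) : ℝ) * t + t ≤ (i : ℕ) * t := by
        intro t l i j ht hij
        rcases lt_or_gt_of_ne (Fin.val_ne_of_ne hij) with h | h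
        · exact Or.inl (nat_mul_add_le h ht)
        · exact Or.inr (nat_mul_add_le h ht)
      rintro (_ | (i | i) | ⟨a, b⟩) - (_ | (j | j) | ⟨c, d⟩) - hij <;>
        simp only [x, y, s, Option.elim, Sum.elim_inl, Sum.elim_inr]
      · exact absurd rfl hij
      · right; right; left; linarith
      · left; linarith
      · left; linarith [(hsub c).1]
      · right; right; right; linarith
      · rcases hne i j hu0.le (by rintro rfl; exact hij rfl) with h | h
        · exact Or.inl h
        · exact Or.inr (Or.inl h)
      · left; linarith [(hrow i).2]
      · left; linarith [(hrow i).2, (hsub c).1]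
      · right; left; linarith
      · right; left; linarith [(hrow j).2]
      · rcases hne i j hu0.le (by rintro rfl; exact hij rfl) with h | h
        · exact Or.inr (Or.inr (Or.inl h))
        · exact Or.inr (Or.inr (Or.inr h))
      · right; right; left; linarith [(hrow i).2, (hsub d).1]
      · right; left; linarith [(hsub a).1]
      · right; left; linarith [(hrow j).2, (hsub a).1]
      · right; right; right; linarith [(hrow j).2, (hsub b).1]
      · by_cases hac : a = c
        · rcases hne b d hv0.le (by rintro rfl; exact hij (by rw [hac])) with h | h
          · right; right; left; linarith
          · right; right; right; linarith
        · rcases hne a c hv0.le hac with h | h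
          · left; linarith
          · right; left; linarith
    · simp only [s, Fintype.sum_option, Fintype.sum_sum_type, Option.elim, Sum.elim_inl,
        Sum.elim_inr, Finset.sum_const, Finset.card_univ, Fintype.card_sum, Fintype.card_prod,
        Fintype.card_fin, nsmul_eq_mul]
      push_cast
      have h1 : (m : ℝ) * m * v ^ 2 = u ^ 2 := by rw [← hv]; ring
      have h2 : ((r + 1) * u) ^ 2 = 1 := by rw [hu, one_pow]
      linarith
  obtain ⟨T, hT, hTs⟩ := P.exists_isSquareTiling (n := n) (by simp [hn]; ring)
  refine ⟨T, hT, ?_⟩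
  rw [hTs]
  have : (Finset.univ : Finset (Option ((Fin r ⊕ Fin r) ⊕ (Fin m × Fin m)))).val.map s =
      {r * u} + ((Finset.univ : Finset (Fin r ⊕ Fin r)).val.map (fun _ => u) +
        (Finset.univ : Finset (Fin m × Fin m)).val.map fun _ => v) := by
    rw [univ_option, ← Finset.univ_disjSum_univ]
    simp [Finset.insertNone, Finset.disjSum, Multiset.disjSum, s, Function.comp_def]
  rw [this, Multiset.map_const', Multiset.map_const', ← add_assoc]
  simp [two_mul, sq]

theorem isLeast_minTilingLength {n : ℕ} {c : ℝ} (h : IsLeast (tilingLengths n) c) :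
    IsLeast (tilingLengths n) (minTilingLength n) ∧ minTilingLength n = c := by
  have : minTilingLength n = c := h.csInf_eq
  exact ⟨this ▸ h, this⟩

/-- The case `m = 1` of the bordered tiling: the corner is a single tile of side `u`. -/
theorem exists_tiling_even {k : ℕ} (hk : 2 ≤ k) :
    ∃ T : Fin (2 * k) → PlaneSquare, IsSquareTiling T ∧ totalLength T = 3 - 2 / (k : ℝ) ∧
      sideLengths T = {((k : ℝ) - 1) / k} + Multiset.replicate (2 * k - 1) (1 / (k : ℝ)) := by
  obtain ⟨r, rfl⟩ : ∃ r, k = r + 1 := ⟨k - 1, by omega⟩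
  have hk0 : ((r : ℝ) + 1) ≠ 0 := by positivity
  obtain ⟨T, hT, hs⟩ := exists_bordered_tiling r 1 (2 * (r + 1)) (by omega) one_pos (by ring)
    (u := 1 / ((r : ℝ) + 1)) (v := 1 / ((r : ℝ) + 1)) (by field_simp) (by simp)
  refine ⟨T, hT, ?_, ?_⟩
  · rw [← sum_sideLengths, hs]
    simp only [Multiset.sum_add, Multiset.sum_singleton, Multiset.sum_replicate, nsmul_eq_mul]
    push_cast
    field_simp
    ring
  · rw [hs, add_assoc, ← Multiset.replicate_add]
    push_cast
    congr 2
    ring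

/-- The case `m = 2`: the corner is cut into four tiles. -/
theorem exists_tiling_odd {k : ℕ} (hk : 2 ≤ k) :
    ∃ T : Fin (2 * k + 3) → PlaneSquare, IsSquareTiling T ∧ totalLength T = 3 - 1 / (k : ℝ) ∧
      sideLengths T = {((k : ℝ) - 1) / k} + Multiset.replicate (2 * k - 2) (1 / (k : ℝ)) +
        Multiset.replicate 4 (1 / (2 * (k : ℝ))) := by
  obtain ⟨r, rfl⟩ : ∃ r, k = r + 1 := ⟨k - 1, by omega⟩
  have hk0 : ((r : ℝ) + 1) ≠ 0 := by positivity
  obtain ⟨T, hT, hs⟩ := exists_bordered_tiling r 2 (2 * (r + 1) + 3) (by omega) two_pos (by ring)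
    (u := 1 / ((r : ℝ) + 1)) (v := 1 / (2 * ((r : ℝ) + 1))) (by field_simp)
    (by push_cast; field_simp)
  refine ⟨T, hT, ?_, ?_⟩
  · rw [← sum_sideLengths, hs]
    simp only [Multiset.sum_add, Multiset.sum_singleton, Multiset.sum_replicate, nsmul_eq_mul]
    push_cast
    field_simp
    ring
  · rw [hs]
    push_cast
    congr 3
    ring

/-! ### The minima. -/

theorem isLeast_tilingLengths_even {k : ℕ} (hk : 2 ≤ k) :
    IsLeast (tilingLengths (2 * k)) (3 - 2 / (k : ℝ)) := by
  constructor
  · obtain ⟨T, hT, hL, -⟩ := exists_tiling_even hk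
    exact ⟨T, hT, hL⟩
  · rintro _ ⟨T, hT, rfl⟩
    obtain ⟨x, y, P⟩ := hT.exists_fullPacking
    exact P.le_sum_of_card_even (by omega) (by simp)

theorem isLeast_tilingLengths_odd {k : ℕ} (hk : 2 ≤ k) :
    IsLeast (tilingLengths (2 * k + 3)) (3 - 1 / (k : ℝ)) := by
  constructor
  · obtain ⟨T, hT, hL, -⟩ := exists_tiling_odd hk
    exact ⟨T, hT, hL⟩
  · rintro _ ⟨T, hT, rfl⟩
    obtain ⟨x, y, P⟩ := hT.exists_fullPacking
    exact P.le_sum_of_card_odd (by omega) (by simp)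

theorem mainTheorem1 :
    (∀ k : ℕ, 2 ≤ k →
      -- the minima exist and have the stated values
      (IsLeast (tilingLengths (2 * k)) (minTilingLength (2 * k)) ∧
        minTilingLength (2 * k) = 3 - 2 / (k : ℝ)) ∧
      (IsLeast (tilingLengths (2 * k + 3)) (minTilingLength (2 * k + 3)) ∧
        minTilingLength (2 * k + 3) = 3 - 1 / (k : ℝ)) ∧
      -- they are attained by tilings with the following tiles
      (∃ T : Fin (2 * k) → PlaneSquare, IsSquareTiling T ∧
        totalLength T = minTilingLength (2 * k) ∧
        sideLengths T = {((k : ℝ) - 1) / k} + Multiset.replicate (2 * k - 1) (1 / (k : ℝ))) ∧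
      (∃ T : Fin (2 * k + 3) → PlaneSquare, IsSquareTiling T ∧
        totalLength T = minTilingLength (2 * k + 3) ∧
        sideLengths T = {((k : ℝ) - 1) / k} + Multiset.replicate (2 * k - 2) (1 / (k : ℝ)) +
          Multiset.replicate 4 (1 / (2 * (k : ℝ))))) ∧
    minTilingLength 7 = 5 / 2 := by
  refine ⟨fun k hk => ?_, ?_⟩
  · have he := isLeast_minTilingLength (isLeast_tilingLengths_even hk)
    have ho := isLeast_minTilingLength (isLeast_tilingLengths_odd hk)
    refine ⟨he, ho, ?_, ?_⟩
    · rw [he.2]; exact exists_tiling_even hk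
    · rw [ho.2]; exact exists_tiling_odd hk
  · have := (isLeast_minTilingLength (isLeast_tilingLengths_odd le_rfl)).2
    norm_num at this
    exact this
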